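/- All rings are commutative and Noetherian. For a reduced ring $R$ let $K(R)$ be its total ring of fractions, $R^{\mathrm N}$ its normalization (the integral closure of $R$ in $K(R)$), and $\mathfrak c=\operatorname{Ann}_R(R^{\mathrm N}/R)$ its conductor, which is an ideal of both $R$ and $R^{\mathrm N}$. For a ring $R$ of prime characteristic $p$ let $F^e_*R$ be the $R$-module with underlying additive group $R$ and scalar multiplication $r\cdot x=r^{p^e}x$; $R$ is $F$-finite if $F_*R$ is a finitely generated $R$-module. Say, recursively, that a reduced local ring $R$ has hereditary surjective trace if either $R$ is normal, or there are minimal primes $\mathfrak p\subset R$ and $\mathfrak q\subset R^{\mathrm N}$ of the conductor $\mathfrak c$, with $\mathfrak q\cap R=\mathfrak p$, such that (i) the trace map $\mathrm{Tr}\colon (R^{\mathrm N}/\mathfrak q)^{\mathrm N}\to (R/\mathfrak p)^{\mathrm N}$, induced by the field trace $K(R^{\mathrm N}/\mathfrak q)\to K(R/\mathfrak p)$, is surjective, and (ii) the local ring $R/\mathfrak p$ has hereditary surjective trace. An affine scheme $X=\operatorname{Spec}R$ (or the reduced ring $R$) has hereditary surjective trace if every local ring $R_P$, $P\in\operatorname{Spec}R$,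 does. **Theorem.** Let $X=\operatorname{Spec}R$ be a reduced affine $F$-finite scheme of prime characteristic $p$ having hereditary surjective trace, let $e\ge 0$, and let $\phi\colon F^e_*R\to R$ be an $R$-linear map. Then $\phi$ extends uniquely to an $R^{\mathrm N}$-linear map $\overline\phi\colon F^e_*R^{\mathrm N}\to R^{\mathrm N}$, and if $\overline\phi$ is surjective, then $\phi$ is surjective. -/

import Mathlib

universe u

noncomputable section

/-- The Frobenius pushforward `F^e_* R`: the additive group of `R`, on which `r : R` acts as
multiplication by `r ^ (p ^ e)`. -/
def FrobeniusPushforward (_p _e : ℕ) (R : Type u) : Type u := R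

namespace FrobeniusPushforward

instance (p e : ℕ) (R : Type u) [CommRing R] : AddCommGroup (FrobeniusPushforward p e R) :=
  inferInstanceAs (AddCommGroup R)

/-- The identity, as an isomorphism of additive groups from `R` to `F^e_* R`. -/
def of (p e : ℕ) (R : Type u) [CommRing R] : R ≃+ FrobeniusPushforward p e R := AddEquiv.refl R

instance (p e : ℕ) (R : Type u) [CommRing R] [Fact p.Prime] [CharP R p] :
    Module R (FrobeniusPushforward p e R) :=
  Module.compHom R (iterateFrobenius R p e)

theorem smul_of (p e : ℕ) (R : Type u) [CommRing R] [Fact p.Prime] [CharP R p] (r x : R) :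
    r • of p e R x = of p e R (r ^ p ^ e * x) :=
  rfl

end FrobeniusPushforward

/-- A ring of prime characteristic `p` is `F`-finite if `F_* R` is a finitely generated
`R`-module. -/
def IsFFinite (p : ℕ) (R : Type u) [CommRing R] [Fact p.Prime] [CharP R p] : Prop :=
  Module.Finite R (FrobeniusPushforward p 1 R)

/-- The normalization of `R`: its integral closure in its total ring of fractions (Mathlib's
`FractionRing R` is the localization of `R` at all its nonzerodivisors). -/
abbrev Normalization (R : Type u) [CommRing R] : Type u :=
  integralClosure R (FractionRing R)

instance (p : ℕ) (R : Type u) [CommRing R] [CharP R p] : CharP (Normalization R) p :=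
  charP_of_injective_algebraMap (R := R) (A := Normalization R)
    (Function.Injective.of_comp (f := algebraMap (Normalization R) (FractionRing R))
      (IsFractionRing.injective R (FractionRing R))) p

/-- The conductor of `R` in its normalization, `Ann_R (R^N / R)`, as an ideal of `R`. -/
def conductorIdeal (R : Type u) [CommRing R] : Ideal R :=
  Module.annihilator R (Normalization R ⧸ LinearMap.range (Algebra.linearMap R (Normalization R)))

theorem mem_conductorIdeal (R : Type u) [CommRing R] (r : R) :
    r ∈ conductorIdeal R ↔
      ∀ x : Normalization R, ∃ s : R,
        algebraMap R (Normalization R) s = algebraMap R (Normalization R) r * x := by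
  rw [conductorIdeal, Module.mem_annihilator, (Submodule.mkQ_surjective _).forall]
  refine forall_congr' fun x => ?_
  rw [← map_smul, Submodule.mkQ_apply, Submodule.Quotient.mk_eq_zero, LinearMap.mem_range,
    Algebra.smul_def]
  rfl

/-- The conductor as an ideal of the normalization: it is the image of the conductor in `R`
(see `mem_normalizationConductor`). -/
def normalizationConductor (R : Type u) [CommRing R] : Ideal (Normalization R) :=
  (conductorIdeal R).map (algebraMap R (Normalization R))

theorem mem_normalizationConductor (R : Type u) [CommRing R] (y : Normalization R) :
    y ∈ normalizationConductor R ↔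
      ∃ r ∈ conductorIdeal R, algebraMap R (Normalization R) r = y := by
  refine ⟨fun hy => ?_, fun ⟨r, hr, h⟩ => h ▸ Ideal.mem_map_of_mem _ hr⟩
  refine Submodule.span_induction ?_ ⟨0, zero_mem _, map_zero _⟩ ?_ ?_ hy
  · rintro _ ⟨r, hr, rfl⟩
    exact ⟨r, hr, rfl⟩
  · rintro _ _ _ _ ⟨r, hr, rfl⟩ ⟨s, hs, rfl⟩
    exact ⟨r + s, add_mem hr hs, map_add _ _ _⟩
  · rintro a _ _ ⟨r, hr, rfl⟩
    obtain ⟨s, hs⟩ := (mem_conductorIdeal R r).1 hr a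
    refine ⟨s, (mem_conductorIdeal R s).2 fun x => ?_, by rw [hs, smul_eq_mul, mul_comm]⟩
    obtain ⟨t, ht⟩ := (mem_conductorIdeal R r).1 hr (a * x)
    exact ⟨t, by rw [ht, hs, mul_assoc]⟩

/-- For an inclusion `A ⊆ B` of domains, the field trace `Frac B → Frac A` maps the normalization
of `B` onto the normalization of `A`. (For integral extensions, as below, it always maps the
normalization of `B` into that of `A`.) -/
def TraceSurjective (A B : Type u) [CommRing A] [IsDomain A] [CommRing B] [IsDomain B]
    [Algebra A B] [FaithfulSMul A B] : Prop :=
  letI : Algebra (FractionRing A) (FractionRing B) := FractionRing.liftAlgebra A (FractionRing B)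
  ∀ y ∈ integralClosure A (FractionRing A), ∃ x ∈ integralClosure B (FractionRing B),
    Algebra.trace (FractionRing A) (FractionRing B) x = y

/-- Hereditary surjective trace for a reduced local ring `R`: either `R` is normal, or there are
minimal primes `𝔭 ⊂ R` and `𝔮 ⊂ R^N` of the conductor, with `𝔮` lying over `𝔭`, such that the trace
`(R^N/𝔮)^N → (R/𝔭)^N` is surjective and the local ring `R/𝔭` again has hereditary surjective
trace. -/
inductive LocalHereditarySurjectiveTrace : (R : Type u) → [CommRing R] → Prop
  | of_normal (R : Type u) [CommRing R] (h : IsIntegrallyClosed R) :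
      LocalHereditarySurjectiveTrace R
  | of_trace (R : Type u) [CommRing R] (𝔭 : Ideal R) (𝔮 : Ideal (Normalization R))
      [𝔭.IsPrime] [𝔮.IsPrime] [𝔮.LiesOver 𝔭]
      (h𝔭 : 𝔭 ∈ (conductorIdeal R).minimalPrimes)
      (h𝔮 : 𝔮 ∈ (normalizationConductor R).minimalPrimes)
      (htrace : TraceSurjective (R ⧸ 𝔭) (Normalization R ⧸ 𝔮))
      (h : LocalHereditarySurjectiveTrace (R ⧸ 𝔭)) :
      LocalHereditarySurjectiveTrace R

/-- A ring has hereditary surjective trace if all its localizations at primes do. -/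
def HereditarySurjectiveTrace (R : Type u) [CommRing R] : Prop :=
  ∀ (P : Ideal R) [P.IsPrime], LocalHereditarySurjectiveTrace (Localization.AtPrime P)

/-- The map `ψ : F^e_* R^N → R^N` extends `φ : F^e_* R → R`. -/
def ExtendsToNormalization (p e : ℕ) (R : Type u) [CommRing R] [Fact p.Prime] [CharP R p]
    (φ : FrobeniusPushforward p e R →ₗ[R] R)
    (ψ : FrobeniusPushforward p e (Normalization R) →ₗ[Normalization R] Normalization R) : Prop :=
  ∀ x : R,
    ψ (FrobeniusPushforward.of p e (Normalization R) (algebraMap R (Normalization R) x)) =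
      algebraMap R (Normalization R) (φ (FrobeniusPushforward.of p e R x))

end

/-! View `φ` as an additive map `f` with `f (r ^ q * x) = r * f x`, `q = p ^ e`. Any extension must
satisfy `s * g (a / s) = f (s ^ (q - 1) * a)`, which defines it on the total ring of fractions and
makes it unique; a determinant argument (`isIntegral_apply`) shows that it preserves integral
elements.

For surjectivity, the image of `f` is an ideal, so one may localize and assume `R` local. The
conductor is stable under `f` and under the extension `g`. If `g` is surjective and `q > 1`, a
`g`-stable ideal is radical, and the minimal primes of a stable radical ideal are stable. Hence `f`
and `g` descend to `R/𝔭` and `R^N/𝔮`. The trace of a finite separable extension commutes with such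
maps (`trace_apply`), so a surjective trace carries surjectivity from `R^N/𝔮` to `(R/𝔭)^N`. By
induction the map on `R/𝔭` is surjective; thus `f` takes a value that is a unit modulo `𝔭`, hence a
unit of the local ring `R`. -/

theorem Ideal.exists_mul_mem_of_mem_minimalPrimes_of_isRadical {R : Type*} [CommRing R]
    {I P : Ideal R} (hI : I.IsRadical) (hP : P ∈ I.minimalPrimes) {x : R} (hx : x ∈ P) :
    ∃ s ∉ P, s * x ∈ I := by
  have hprime := hP.1.1
  have hle : P.map (algebraMap R (Localization.AtPrime P)) ≤ (I.map (algebraMap _ _)).radical := by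
    -- A prime of the localization containing `I` contracts to a prime between `I` and `P`, hence to
    -- `P` by minimality.
    rw [Ideal.radical_eq_sInf, le_sInf_iff]
    rintro q ⟨hq', hq⟩
    obtain ⟨h₁, h₂⟩ := ((IsLocalization.AtPrime.orderIsoOfPrime _ P) ⟨q, hq⟩).2
    rw [Ideal.map_le_iff_le_comap] at hq' ⊢
    exact hP.2 ⟨h₁, hq'⟩ h₂
  obtain ⟨n, hn⟩ := hle (Ideal.mem_map_of_mem _ hx)
  rw [IsLocalization.mem_map_algebraMap_iff (M := P.primeCompl)] at hn
  obtain ⟨⟨a, b⟩, hn⟩ := hn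
  rw [← map_pow, ← map_mul, IsLocalization.eq_iff_exists P.primeCompl] at hn
  obtain ⟨t, ht⟩ := hn
  refine ⟨t * b, (t * b).2, hI ⟨n + 1, ?_⟩⟩
  have hpow : ((t.1 * b.1) * x) ^ (n + 1) = (t.1 ^ n * b.1 ^ n * x * t.1) * a := by
    rw [mul_assoc _ t.1, ← ht]; ring
  rw [hpow]
  exact I.mul_mem_left _ a.2

/-! ### Root-linear maps and their extensions to fractions and to the normalization -/

/-- An additive endomorphism `f` of a commutative ring is `q⁻¹`-linear if
`f (r ^ q * x) = r * f x`. -/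
def IsRootLinear (q : ℕ) {R : Type*} [CommRing R] (f : R →+ R) : Prop :=
  ∀ r x, f (r ^ q * x) = r * f x

namespace IsRootLinear

variable {q : ℕ} {R A : Type*} [CommRing R] [CommRing A] {f : R →+ R} {g : A →+ A}

theorem surjective_of_apply_eq_one (hf : IsRootLinear q f) {u : R} (hu : f u = 1) :
    Function.Surjective f :=
  fun r => ⟨r ^ q * u, by rw [hf, hu, mul_one]⟩

theorem mul_apply_eq (hq : q ≠ 0) (j : R →+* A) (hg : IsRootLinear q g)
    (hext : ∀ x, g (j x) = j (f x)) {s a : R} {z : A} (h : j s * z = j a) :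
    j s * g z = j (f (s ^ (q - 1) * a)) := by
  obtain ⟨n, rfl⟩ := Nat.exists_eq_succ_of_ne_zero hq
  rw [← hg, ← hext, Nat.succ_sub_one, map_mul j, map_pow j, ← h, pow_succ, mul_assoc]

/-- Multiplied by `m (j s)`, both sides become `m (j (f (s ^ (q - 1) * a)))`. With `m` the identity
this is uniqueness of extensions; in general it makes extensions to different rings compatible. -/
theorem apply_map_eq {B : Type*} [CommRing B] (hq : q ≠ 0) (j : R →+* A) (m : A →+* B)
    (hg : IsRootLinear q g) (hext : ∀ x, g (j x) = j (f x)) {h : B →+ B} (hh : IsRootLinear q h)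
    (hhext : ∀ x, h (m (j x)) = m (j (f x))) {s a : R} {z : A} (hz : j s * z = j a)
    (hs : m (j s) ∈ nonZeroDivisors B) : h (m z) = m (g z) := by
  have h1 := mul_apply_eq hq j hg hext hz
  have h2 := mul_apply_eq hq (m.comp j) hh hhext (z := m z) (s := s) (a := a)
    (by simp only [RingHom.comp_apply]; rw [← map_mul, hz])
  simp only [RingHom.comp_apply] at h2
  rw [← h1, map_mul] at h2
  exact (mul_cancel_left_mem_nonZeroDivisors hs).1 h2

theorem exists_extension_localization (hq : q ≠ 0) (hf : IsRootLinear q f) (S : Submonoid R)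
    (K : Type*) [CommRing K] [Algebra R K] [IsLocalization S K] :
    ∃ g : K →+ K, IsRootLinear q g ∧ ∀ x, g (algebraMap R K x) = algebraMap R K (f x) := by
  obtain ⟨n, rfl⟩ := Nat.exists_eq_succ_of_ne_zero hq
  -- Asking one `y` to serve every presentation `a / s` of `z` settles well-definedness and leaves
  -- the denominator free afterwards.
  have hex : ∀ z : K, ∃ y : K, ∀ (a : R) (s : S), algebraMap R K s * z = algebraMap R K a →
      algebraMap R K s * y = algebraMap R K (f (s ^ n * a)) := by
    intro z
    obtain ⟨⟨b, t⟩, hb⟩ := IsLocalization.surj S z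
    obtain ⟨y, hy⟩ := (IsLocalization.map_units K t).dvd (a := algebraMap R K (f (t ^ n * b)))
    refine ⟨y, fun a s ha => ?_⟩
    have h1 : algebraMap R K (t * a) = algebraMap R K (s * b) := by
      rw [map_mul, map_mul, ← ha, ← hb]; ring
    obtain ⟨u, hu⟩ := (IsLocalization.eq_iff_exists S K).1 h1
    refine ((IsLocalization.map_units K u).mul (IsLocalization.map_units K t)).mul_left_cancel ?_
    have h2 : algebraMap R K u * algebraMap R K t * algebraMap R K (f (s ^ n * a)) =
        algebraMap R K (f ((u * s) ^ (n + 1) * (t ^ n * b))) := by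
      rw [← map_mul, ← map_mul, ← hf]
      congr 2
      calc ((u : R) * t) ^ (n + 1) * (s ^ n * a) = u ^ n * t ^ n * s ^ n * (u * (t * a)) := by ring
        _ = _ := by rw [hu]; ring
    rw [h2, hf, map_mul, map_mul, hy]
    ring
  choose g hg using hex
  refine ⟨⟨⟨g, ?_⟩, ?_⟩, ?_, ?_⟩
  · have := hg 0 0 1 (by simp)
    simpa using this
  · intro y z
    obtain ⟨a, b, s, ha, hb⟩ := IsLocalization.surj₂ S K y z
    have ha' := (mul_comm _ _).trans ha
    have hb' := (mul_comm _ _).trans hb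
    refine (IsLocalization.map_units K s).mul_left_cancel ?_
    change _ = _ * (g y + g z)
    rw [hg (y + z) (a + b) s (by rw [mul_add, ha', hb', map_add]), mul_add (_ ^ n), map_add, map_add,
      mul_add (algebraMap R K s), hg y a s ha', hg z b s hb']
  · intro r z
    change g (r ^ (n + 1) * z) = r * g z
    obtain ⟨a, b, s, ha, hb⟩ := IsLocalization.surj₂ S K r z
    have ha' := (mul_comm _ _).trans ha
    have hb' := (mul_comm _ _).trans hb
    -- With `q = n + 1`, `r = a / s` and `z = b / s`, the element `r ^ q * z` has denominator `s ^
    -- (n + 2)`.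
    refine ((IsLocalization.map_units K s).mul
      (IsLocalization.map_units K (s ^ (n + 2)))).mul_left_cancel ?_
    have h1 := hg (r ^ (n + 1) * z) (a ^ (n + 1) * b) (s ^ (n + 2)) (by
      rw [map_mul, map_pow, ← ha', ← hb', SubmonoidClass.coe_pow, map_pow]; ring)
    have h2 := hg z (s ^ (n + 1) * b) (s ^ (n + 2)) (by
      rw [map_mul, map_pow, ← hb', SubmonoidClass.coe_pow, map_pow]; ring)
    rw [mul_left_comm, hf, map_mul] at h1 h2
    rw [mul_assoc, h1, ← ha']
    linear_combination -(algebraMap R K s) * r * h2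
  · intro x
    have := hg (algebraMap R K x) x 1 (by simp)
    simpa using this

/-- The elements of `R` multiplying `R[x]` into `R` form an ideal stable under every `q⁻¹`-linear
map, and the image of `x` multiplies that ideal into itself. -/
theorem isIntegral_apply [IsNoetherianRing R] {S : Submonoid R} {K : Type*} [CommRing K]
    [Algebra R K] [IsLocalization S K] (hq : q ≠ 0) {g : K →+ K} (hg : IsRootLinear q g)
    (hext : ∀ x, g (algebraMap R K x) = algebraMap R K (f x)) {x : K} (hx : IsIntegral R x) :
    IsIntegral R (g x) := by
  have hfg := hx.fg_adjoin_singleton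
  obtain ⟨T, hT⟩ := hfg
  obtain ⟨c, hc⟩ := IsLocalization.exist_integer_multiples_of_finset S T
  have hcR : ∀ y ∈ Algebra.adjoin R {x}, ∃ r, algebraMap R K r = algebraMap R K c * y := by
    intro y hy
    rw [← Subalgebra.mem_toSubmodule, ← hT] at hy
    induction hy using Submodule.span_induction with
    | mem y hy =>
      obtain ⟨r, hr⟩ := hc y hy
      exact ⟨r, by rw [hr, Algebra.smul_def]⟩
    | zero => exact ⟨0, by simp⟩
    | add y z _ _ hy hz =>
      obtain ⟨r, hr⟩ := hy
      obtain ⟨s, hs⟩ := hz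
      exact ⟨r + s, by rw [map_add, hr, hs, mul_add]⟩
    | smul a y _ hy =>
      obtain ⟨r, hr⟩ := hy
      exact ⟨a * r, by rw [map_mul, hr, Algebra.smul_def, mul_left_comm]⟩
  let I : Ideal R :=
    { carrier := {r | ∀ y ∈ Algebra.adjoin R {x}, ∃ s, algebraMap R K s = algebraMap R K r * y}
      zero_mem' := fun y _ => ⟨0, by simp⟩
      add_mem' := fun {a b} ha hb y hy => by
        obtain ⟨r, hr⟩ := ha y hy
        obtain ⟨s, hs⟩ := hb y hy
        exact ⟨r + s, by rw [map_add, hr, hs, map_add, add_mul]⟩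
      smul_mem' := fun a b hb y hy => by
        obtain ⟨r, hr⟩ := hb y hy
        exact ⟨a * r, by rw [map_mul, hr, smul_eq_mul, map_mul, mul_assoc]⟩ }
  -- Here `y * f r = g (y ^ q * r)`, and `y ^ q` is still in `R[x]`.
  have hIf : ∀ r ∈ I, f r ∈ I := by
    intro r hr y hy
    obtain ⟨s, hs⟩ := hr (y ^ q) (pow_mem hy q)
    exact ⟨f s, by rw [← hext, hs, mul_comm, hg, hext, mul_comm]⟩
  have hImul : ∀ r ∈ I, ∀ y ∈ Algebra.adjoin R {x},
      ∃ s ∈ I, algebraMap R K s = algebraMap R K r * y := by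
    intro r hr y hy
    obtain ⟨s, hs⟩ := hr y hy
    refine ⟨s, fun z hz => ?_, hs⟩
    obtain ⟨t, ht⟩ := hr (y * z) (mul_mem hy hz)
    exact ⟨t, by rw [ht, hs, mul_assoc]⟩
  have hgI : ∀ r ∈ I, ∃ s ∈ I, algebraMap R K s = g x * algebraMap R K r := by
    intro r hr
    obtain ⟨n, rfl⟩ := Nat.exists_eq_succ_of_ne_zero hq
    obtain ⟨s, hs, hs'⟩ := hImul (r ^ (n + 1)) (I.pow_mem_of_mem hr _ n.succ_pos) x
      (Algebra.self_mem_adjoin_singleton R x)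
    exact ⟨f s, hIf s hs, by rw [← hext, hs', map_pow, hg, mul_comm]⟩
  let N : Submodule R K := Submodule.map (Algebra.linearMap R K) I
  have hN : ∀ y ∈ N, g x * y ∈ N := by
    rintro _ ⟨r, hr, rfl⟩
    obtain ⟨s, hs, hs'⟩ := hgI r hr
    exact ⟨s, hs, hs'⟩
  have hcN : algebraMap R K c ∈ N := ⟨c, hcR, rfl⟩
  let T : Module.End R N := (LinearMap.mulLeft R (g x)).restrict hN
  have : Module.Finite R N := Module.Finite.of_fg ((IsNoetherian.noetherian I).map _)
  -- Cayley–Hamilton: `P (g x)` kills `N`, which contains `c`, a unit of `K`; so `P (g x) = 0`.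
  obtain ⟨P, hP, hPT⟩ := LinearMap.exists_monic_and_aeval_eq_zero R T
  refine ⟨P, hP, ?_⟩
  have haeval : ∀ (Q : Polynomial R) (y : N),
      (Polynomial.aeval T Q y : K) = Polynomial.aeval (g x) Q * y := by
    intro Q y
    induction Q using Polynomial.induction_on' with
    | add Q₁ Q₂ h₁ h₂ => simp [h₁, h₂, add_mul]
    | monomial n a =>
      have hpow : ((T ^ n) y : K) = g x ^ n * y := by
        induction n with
        | zero => simp
        | succ n ih => rw [pow_succ', Module.End.mul_apply, pow_succ', mul_assoc, ← ih]; rfl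
      simp [Polynomial.aeval_monomial, hpow, Algebra.smul_def, mul_assoc]
  have h0 := haeval P ⟨_, hcN⟩
  rw [hPT] at h0
  exact ((IsLocalization.map_units K c).mul_left_eq_zero).1 h0.symm

theorem exists_extension_normalization [IsNoetherianRing R] (hq : q ≠ 0) (hf : IsRootLinear q f) :
    ∃ g : Normalization R →+ Normalization R, IsRootLinear q g ∧
      ∀ x, g (algebraMap R _ x) = algebraMap R _ (f x) := by
  obtain ⟨g, hg, hext⟩ := hf.exists_extension_localization hq (nonZeroDivisors R) (FractionRing R)
  refine ⟨⟨⟨fun x => ⟨g x, isIntegral_apply (S := nonZeroDivisors R) hq hg hext x.2⟩, ?_⟩, ?_⟩,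
    ?_, ?_⟩
  · exact Subtype.ext (map_zero g)
  · exact fun x y => Subtype.ext (map_add g _ _)
  · exact fun x y => Subtype.ext (hg _ _)
  · exact fun x => Subtype.ext (hext x)

/-! ### Stable ideals and the conductor -/

theorem exists_quotient (hf : IsRootLinear q f) {I : Ideal R} (hI : ∀ x ∈ I, f x ∈ I) :
    ∃ g : R ⧸ I →+ R ⧸ I, IsRootLinear q g ∧
      ∀ x, g (Ideal.Quotient.mk I x) = Ideal.Quotient.mk I (f x) := by
  have key : ∀ x, Ideal.Quotient.mk I (f (Ideal.Quotient.mk I x).out) = Ideal.Quotient.mk I (f x) := by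
    intro x
    rw [Ideal.Quotient.eq, ← map_sub]
    exact hI _ (Ideal.Quotient.eq.1 (Ideal.Quotient.mk_out _))
  refine ⟨⟨⟨fun x => Ideal.Quotient.mk I (f x.out), ?_⟩, ?_⟩, ?_, key⟩
  · simpa using key 0
  · intro x y
    obtain ⟨x, rfl⟩ := Ideal.Quotient.mk_surjective x
    obtain ⟨y, rfl⟩ := Ideal.Quotient.mk_surjective y
    change Ideal.Quotient.mk I (f (Ideal.Quotient.mk I x + Ideal.Quotient.mk I y).out) =
      Ideal.Quotient.mk I (f (Ideal.Quotient.mk I x).out) +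
        Ideal.Quotient.mk I (f (Ideal.Quotient.mk I y).out)
    rw [← map_add, key, key, key, map_add, map_add]
  · intro x y
    obtain ⟨x, rfl⟩ := Ideal.Quotient.mk_surjective x
    obtain ⟨y, rfl⟩ := Ideal.Quotient.mk_surjective y
    change Ideal.Quotient.mk I (f (Ideal.Quotient.mk I x ^ q * Ideal.Quotient.mk I y).out) =
      Ideal.Quotient.mk I x * Ideal.Quotient.mk I (f (Ideal.Quotient.mk I y).out)
    rw [← map_pow, ← map_mul, key, key, hf, map_mul]

/-- If `f u = 1`, then `x = f (x ^ q * u)`. -/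
theorem mem_of_pow_mem {I : Ideal R} (hf : IsRootLinear q f) (hI : ∀ x ∈ I, f x ∈ I)
    (hsurj : Function.Surjective f) {x : R} (hx : x ^ q ∈ I) : x ∈ I := by
  obtain ⟨u, hu⟩ := hsurj 1
  have := hI _ (I.mul_mem_right u hx)
  rwa [hf, hu, mul_one] at this

theorem isRadical_of_surjective {I : Ideal R} (hq : 1 < q) (hf : IsRootLinear q f)
    (hI : ∀ x ∈ I, f x ∈ I) (hsurj : Function.Surjective f) : I.IsRadical := by
  rintro x ⟨n, hn⟩
  have hle : ∀ m, x ^ q ^ m ∈ I → x ∈ I := by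
    intro m
    induction m with
    | zero => simp
    | succ m ih =>
      intro h
      rw [pow_succ, pow_mul] at h
      exact ih (hf.mem_of_pow_mem hI hsurj h)
  exact hle n (I.pow_mem_of_pow_mem hn (Nat.lt_pow_self hq).le)

/-- Some `s ∉ P` has `s * x ∈ I`, so `s * f x = f (s ^ q * x)` lies in `I ⊆ P`. -/
theorem apply_mem_of_mem_minimalPrimes {I P : Ideal R} (hq : q ≠ 0) (hf : IsRootLinear q f)
    (hI : ∀ x ∈ I, f x ∈ I) (hrad : I.IsRadical) (hP : P ∈ I.minimalPrimes) {x : R} (hx : x ∈ P) :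
    f x ∈ P := by
  have := hP.1.1
  obtain ⟨s, hs, hsx⟩ := Ideal.exists_mul_mem_of_mem_minimalPrimes_of_isRadical hrad hP hx
  have h1 : s * f x ∈ P := by
    rw [← hf]
    refine hP.1.2 (hI _ ?_)
    rw [← Nat.sub_add_cancel (Nat.one_le_iff_ne_zero.2 hq), pow_succ, mul_assoc]
    exact I.mul_mem_left _ hsx
  exact (this.mem_or_mem h1).resolve_left hs

/-- For `x` in the normalization, `x * f r = g (x ^ q * r)`, and `x ^ q * r` lies in `R`. -/
theorem apply_mem_conductorIdeal {g : Normalization R →+ Normalization R} (hg : IsRootLinear q g)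
    (hext : ∀ x, g (algebraMap R _ x) = algebraMap R _ (f x)) {r : R} (hr : r ∈ conductorIdeal R) :
    f r ∈ conductorIdeal R := by
  rw [mem_conductorIdeal] at hr ⊢
  intro x
  obtain ⟨s, hs⟩ := hr (x ^ q)
  exact ⟨f s, by rw [← hext, hs, mul_comm, hg, hext, mul_comm]⟩

theorem apply_mem_normalizationConductor {g : Normalization R →+ Normalization R}
    (hg : IsRootLinear q g) (hext : ∀ x, g (algebraMap R _ x) = algebraMap R _ (f x))
    {y : Normalization R} (hy : y ∈ normalizationConductor R) :
    g y ∈ normalizationConductor R := by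
  rw [mem_normalizationConductor] at hy ⊢
  obtain ⟨r, hr, rfl⟩ := hy
  exact ⟨f r, apply_mem_conductorIdeal hg hext hr, (hext r).symm⟩

end IsRootLinear

theorem algebraMap_normalization_injective (R : Type*) [CommRing R] :
    Function.Injective (algebraMap R (Normalization R)) :=
  Function.Injective.of_comp (f := algebraMap (Normalization R) (FractionRing R))
    (IsFractionRing.injective R (FractionRing R))

theorem conductorIdeal_isRadical {R : Type*} [CommRing R] (h : (normalizationConductor R).IsRadical) :
    (conductorIdeal R).IsRadical := by
  rintro x ⟨n, hn⟩
  have : algebraMap R (Normalization R) x ∈ normalizationConductor R :=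
    h ⟨n, by rw [← map_pow]; exact Ideal.mem_map_of_mem _ hn⟩
  obtain ⟨r, hr, hrx⟩ := (mem_normalizationConductor R _).1 this
  rwa [← algebraMap_normalization_injective R hrx]

/-! ### Descent of surjectivity along the trace -/

theorem Algebra.trace_pow_char_pow {k l : Type*} [Field k] [Field l] [Algebra k l]
    [FiniteDimensional k l] [Algebra.IsSeparable k l] (p e : ℕ) [Fact p.Prime] [CharP k p] (z : l) :
    Algebra.trace k l (z ^ p ^ e) = Algebra.trace k l z ^ p ^ e := by
  have : CharP (AlgebraicClosure k) p :=
    charP_of_injective_algebraMap (algebraMap k (AlgebraicClosure k)).injective p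
  apply (algebraMap k (AlgebraicClosure k)).injective
  rw [map_pow (algebraMap k _), trace_eq_sum_embeddings, trace_eq_sum_embeddings, sum_pow_char_pow]
  simp_rw [map_pow]

namespace IsRootLinear

/-- The trace of a finite separable extension commutes with `q⁻¹`-linear maps, because the `q`-th
powers span the extension. -/
theorem trace_apply {k l : Type*} [Field k] [Field l] [Algebra k l]
    [FiniteDimensional k l] [Algebra.IsSeparable k l] (p e : ℕ) [Fact p.Prime] [CharP k p]
    {f : k →+ k} {g : l →+ l} (hf : IsRootLinear (p ^ e) f) (hg : IsRootLinear (p ^ e) g)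
    (hext : ∀ x, g (algebraMap k l x) = algebraMap k l (f x)) (y : l) :
    Algebra.trace k l (g y) = f (Algebra.trace k l y) := by
  have : ExpChar k p := ExpChar.prime Fact.out
  have hspan : y ∈ Submodule.span k (Set.range fun z : l => z ^ p ^ e) := by
    rw [Field.span_map_pow_expChar_pow_eq_top_of_isSeparable (v := fun z : l => z) p e
      (by simp)]
    trivial
  -- Neither side is `k`-linear in `y`, so the scalar is built into the induction hypothesis.
  suffices h : ∀ a : k, Algebra.trace k l (g (a • y)) = f (Algebra.trace k l (a • y)) by
    simpa using h 1
  induction hspan using Submodule.span_induction with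
  | zero => simp
  | add y z _ _ hy hz => intro a; simp only [smul_add, map_add, hy, hz]
  | mem y hy =>
    obtain ⟨z, rfl⟩ := hy
    intro a
    simp only
    rw [map_smul (Algebra.trace k l), Algebra.trace_pow_char_pow p e, smul_eq_mul, mul_comm a, hf, Algebra.smul_def,
      mul_comm, hg, hext, mul_comm, ← Algebra.smul_def, map_smul (Algebra.trace k l), smul_eq_mul, mul_comm]
  | smul b y _ hy => intro a; rw [smul_smul]; exact hy _

end IsRootLinear

theorem charP_of_ringHom_of_nontrivial {R A : Type*} [CommRing R] [CommRing A] [Nontrivial A]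
    (j : R →+* A) (p : ℕ) [hp : Fact p.Prime] [CharP R p] : CharP A p :=
  (CharP.charP_iff_prime_eq_zero hp.out).2 (by rw [← map_natCast j, CharP.cast_eq_zero, map_zero])

/-- If the trace is surjective on normalizations, surjectivity of a `q⁻¹`-linear map passes from
the extension `B` down to the normalization of `A`. -/
theorem TraceSurjective.surjective_of_surjective {A B : Type u} [CommRing A] [IsDomain A]
    [CommRing B] [IsDomain B] [Algebra A B] [FaithfulSMul A B] [Algebra.IsIntegral A B]
    (htr : TraceSurjective A B) (p e : ℕ) [Fact p.Prime] [CharP A p] {f : A →+ A} {g : B →+ B}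
    (hf : IsRootLinear (p ^ e) f) (hg : IsRootLinear (p ^ e) g)
    (hext : ∀ x, g (algebraMap A B x) = algebraMap A B (f x)) (hsurj : Function.Surjective g)
    {f' : Normalization A →+ Normalization A} (hf' : IsRootLinear (p ^ e) f')
    (hfext : ∀ x, f' (algebraMap A _ x) = algebraMap A _ (f x)) : Function.Surjective f' := by
  let : Algebra (FractionRing A) (FractionRing B) := FractionRing.liftAlgebra A (FractionRing B)
  have hq : p ^ e ≠ 0 := pow_ne_zero _ (Fact.out : p.Prime).ne_zero
  have : IsScalarTower A (FractionRing A) (FractionRing B) :=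
    FractionRing.isScalarTower_liftAlgebra A (FractionRing B)
  have : CharP (FractionRing A) p := charP_of_ringHom_of_nontrivial (algebraMap A _) p
  obtain ⟨x, hx, hx1⟩ := htr 1 (one_mem _)
  -- A nonzero trace forces the extension to be finite and separable.
  have hne : Algebra.trace (FractionRing A) (FractionRing B) ≠ 0 := by
    intro h
    rw [h] at hx1
    exact zero_ne_one hx1
  have : Algebra.IsSeparable (FractionRing A) (FractionRing B) := by
    by_contra h
    exact hne (Algebra.trace_eq_zero_of_not_isSeparable h)
  have : FiniteDimensional (FractionRing A) (FractionRing B) := by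
    by_contra h
    refine hne (Algebra.trace_eq_zero_of_not_exists_basis _ ?_)
    rintro ⟨s, ⟨b⟩⟩
    exact h (Module.Finite.of_basis b)
  obtain ⟨F, hF, hFext⟩ :=
    hf.exists_extension_localization hq (nonZeroDivisors A) (FractionRing A)
  obtain ⟨G, hG, hGext⟩ :=
    hg.exists_extension_localization hq (nonZeroDivisors B) (FractionRing B)
  have hGF : ∀ z, G (algebraMap _ _ z) = algebraMap (FractionRing A) (FractionRing B) (F z) := by
    intro z
    obtain ⟨⟨a, s⟩, hs⟩ := IsLocalization.surj (nonZeroDivisors A) z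
    refine IsRootLinear.apply_map_eq hq (algebraMap A (FractionRing A)) (algebraMap _ _) hF hFext hG
      (fun x => ?_) (s := s) (a := a) ((mul_comm _ _).trans hs) ?_
    · rw [← IsScalarTower.algebraMap_apply, ← IsScalarTower.algebraMap_apply,
        IsScalarTower.algebraMap_apply A B (FractionRing B),
        IsScalarTower.algebraMap_apply A B (FractionRing B), hGext, hext]
    · exact ((IsLocalization.map_units (FractionRing A) s).map _).mem_nonZeroDivisors
  obtain ⟨u, hu⟩ := hsurj 1
  have hint : ∀ w : FractionRing B, IsIntegral B w →
      IsIntegral A (Algebra.trace (FractionRing A) (FractionRing B) w) := by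
    intro w hw
    have : IsIntegral A w := isIntegral_trans (R := A) (A := B) w hw
    exact Algebra.isIntegral_trace this
  -- With `g u = 1` and `Tr x = 1`, one gets `F (Tr w) = Tr (G w) = Tr (x * G u) = 1`.
  set w := x ^ p ^ e * algebraMap B (FractionRing B) u
  have hw : IsIntegral B w := (IsIntegral.pow hx _).mul isIntegral_algebraMap
  have hFw : F (Algebra.trace (FractionRing A) (FractionRing B) w) = 1 := by
    rw [← IsRootLinear.trace_apply p e hF hG hGF, hG, hGext, hu, map_one, mul_one, hx1]
  refine hf'.surjective_of_apply_eq_one (u := ⟨_, hint w hw⟩) (Subtype.ext ?_)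
  refine Eq.trans ?_ hFw
  obtain ⟨⟨a, s⟩, hs⟩ := IsLocalization.surj (nonZeroDivisors A)
    (Algebra.trace (FractionRing A) (FractionRing B) w)
  exact (IsRootLinear.apply_map_eq hq (algebraMap A (Normalization A))
    (algebraMap (Normalization A) (FractionRing A)) hf' hfext hF hFext (s := s) (a := a)
    (Subtype.ext ((mul_comm _ _).trans hs))
    (IsLocalization.map_units (FractionRing A) s).mem_nonZeroDivisors).symm

/-! ### The local case -/

theorem LocalHereditarySurjectiveTrace.surjective {R : Type u} [CommRing R]
    (h : LocalHereditarySurjectiveTrace R) (p e : ℕ) [hp : Fact p.Prime] (he : e ≠ 0)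
    [hN : IsNoetherianRing R] [hL : IsLocalRing R] [hC : CharP R p] {f : R →+ R}
    {g : Normalization R →+ Normalization R} (hf : IsRootLinear (p ^ e) f)
    (hg : IsRootLinear (p ^ e) g) (hext : ∀ x, g (algebraMap R _ x) = algebraMap R _ (f x))
    (hsurj : Function.Surjective g) : Function.Surjective f := by
  have hq : 1 < p ^ e := one_lt_pow₀ hp.out.one_lt he
  have hq' : p ^ e ≠ 0 := by lia
  induction h generalizing hN hL hC with
  | of_normal R h =>
    have hbij : Function.Surjective (algebraMap R (Normalization R)) := by
      intro x
      obtain ⟨y, hy⟩ := IsIntegrallyClosed.isIntegral_iff.1 x.2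
      exact ⟨y, Subtype.ext hy⟩
    obtain ⟨u, hu⟩ := hsurj 1
    obtain ⟨u, rfl⟩ := hbij u
    refine hf.surjective_of_apply_eq_one (u := u) (algebraMap_normalization_injective R ?_)
    rw [← hext, hu, map_one]
  | of_trace R P Q hP hQ htr h ih =>
    have hradN : (normalizationConductor R).IsRadical :=
      hg.isRadical_of_surjective hq (fun y hy => IsRootLinear.apply_mem_normalizationConductor hg hext hy) hsurj
    have hrad := conductorIdeal_isRadical hradN
    obtain ⟨f₁, hf₁, hf₁mk⟩ := hf.exists_quotient (I := P) fun x hx =>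
      hf.apply_mem_of_mem_minimalPrimes hq' (fun y hy => IsRootLinear.apply_mem_conductorIdeal hg hext hy)
        hrad hP hx
    obtain ⟨g₁, hg₁, hg₁mk⟩ := hg.exists_quotient (I := Q) fun x hx =>
      hg.apply_mem_of_mem_minimalPrimes hq'
        (fun y hy => IsRootLinear.apply_mem_normalizationConductor hg hext hy) hradN hQ hx
    have : CharP (R ⧸ P) p := charP_of_ringHom_of_nontrivial (Ideal.Quotient.mk P) p
    have : IsLocalRing (R ⧸ P) :=
      IsLocalRing.of_surjective' (Ideal.Quotient.mk P) Ideal.Quotient.mk_surjective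
    obtain ⟨f₂, hf₂, hf₂ext⟩ := hf₁.exists_extension_normalization hq'
    have hsurj₁ : Function.Surjective g₁ := by
      obtain ⟨u, hu⟩ := hsurj 1
      exact hg₁.surjective_of_apply_eq_one (u := Ideal.Quotient.mk Q u) (by rw [hg₁mk, hu, map_one])
    have : Algebra.IsIntegral (R ⧸ P) (Normalization R ⧸ Q) := inferInstance
    have hsurj₂ := htr.surjective_of_surjective p e hf₁ hg₁ (by
      intro x
      obtain ⟨x, rfl⟩ := Ideal.Quotient.mk_surjective x
      rw [Ideal.Quotient.algebraMap_mk_of_liesOver, hg₁mk, hf₁mk, hext,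
        Ideal.Quotient.algebraMap_mk_of_liesOver]) hsurj₁ hf₂ hf₂ext
    obtain ⟨u, hu⟩ := ih hf₁ hf₂ hf₂ext hsurj₂ 1
    obtain ⟨u, rfl⟩ := Ideal.Quotient.mk_surjective u
    have hunit : IsUnit (f u) := by
      have hmk : IsUnit (Ideal.Quotient.mk P (f u)) := by rw [← hf₁mk, hu]; exact isUnit_one
      have := (Ideal.Quotient.mk_surjective (I := P)).isLocalHom
      exact (isUnit_map_iff (Ideal.Quotient.mk P) _).1 hmk
    obtain ⟨c, hc⟩ := hunit.exists_left_inv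
    exact hf.surjective_of_apply_eq_one (u := c ^ p ^ e * u) (by rw [hf, hc])

/-! ### From local to global -/

/-- The underlying additive endomorphism of an `R`-linear map `F^e_* R → R`. -/
def FrobeniusPushforward.toAddHom {p e : ℕ} {R : Type u} [CommRing R] [Fact p.Prime] [CharP R p]
    (φ : FrobeniusPushforward p e R →ₗ[R] R) : R →+ R :=
  φ.toAddMonoidHom.comp (FrobeniusPushforward.of p e R).toAddMonoidHom

theorem FrobeniusPushforward.isRootLinear_toAddHom {p e : ℕ} {R : Type u} [CommRing R]
    [Fact p.Prime] [CharP R p] (φ : FrobeniusPushforward p e R →ₗ[R] R) :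
    IsRootLinear (p ^ e) (toAddHom φ) :=
  fun r x => φ.map_smul r (of p e R x)

/-- The `R`-linear map `F^e_* R → R` given by a `p^e`-inverse-linear endomorphism. -/
def IsRootLinear.toLinearMap {p e : ℕ} {R : Type u} [CommRing R] [Fact p.Prime] [CharP R p]
    {f : R →+ R} (hf : IsRootLinear (p ^ e) f) : FrobeniusPushforward p e R →ₗ[R] R where
  toFun x := f ((FrobeniusPushforward.of p e R).symm x)
  map_add' _ _ := map_add f _ _
  map_smul' r _ := hf r _

/-- A `q⁻¹`-linear map of `R` whose extension to the normalization is surjective induces such a map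
on each localization of `R` at a prime. -/
theorem IsRootLinear.exists_localization_extension {q : ℕ} (hq : q ≠ 0) {R : Type u} [CommRing R]
    [IsNoetherianRing R] {f : R →+ R} (hf : IsRootLinear q f)
    {g : Normalization R →+ Normalization R} (hg : IsRootLinear q g)
    (hext : ∀ x, g (algebraMap R _ x) = algebraMap R _ (f x)) (hsurj : Function.Surjective g)
    (P : Ideal R) [P.IsPrime] :
    ∃ (f' : Localization.AtPrime P →+ Localization.AtPrime P)
      (g' : Normalization (Localization.AtPrime P) →+ Normalization (Localization.AtPrime P)),
      IsRootLinear q f' ∧ IsRootLinear q g' ∧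
      (∀ x, f' (algebraMap R _ x) = algebraMap R _ (f x)) ∧
      (∀ x, g' (algebraMap _ _ x) = algebraMap _ _ (f' x)) ∧ Function.Surjective g' := by
  let T := Localization.AtPrime P
  have : IsNoetherianRing T := IsLocalization.isNoetherianRing P.primeCompl T inferInstance
  obtain ⟨f', hf', hf'ext⟩ := hf.exists_extension_localization hq P.primeCompl T
  obtain ⟨g', hg', hg'ext⟩ := hf'.exists_extension_normalization hq
  refine ⟨f', g', hf', hg', hf'ext, hg'ext, ?_⟩
  -- Nonzerodivisors survive localization, so `R^N` maps to `T^N`, and a preimage of `1` under `g`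
  -- can be transported.
  have hnzd : ∀ s ∈ nonZeroDivisors R, IsUnit (algebraMap R (FractionRing T) s) := by
    intro s hs
    rw [IsScalarTower.algebraMap_apply R T (FractionRing T)]
    exact IsLocalization.map_units (FractionRing T)
      ⟨algebraMap R T s, IsLocalization.map_nonZeroDivisors_le P.primeCompl T ⟨s, hs, rfl⟩⟩
  let m : FractionRing R →+* FractionRing T :=
    IsLocalization.lift (M := nonZeroDivisors R) (g := algebraMap R (FractionRing T))
      fun s => hnzd s s.2
  have hm : ∀ x, m (algebraMap R _ x) = algebraMap R _ x := fun x => IsLocalization.lift_eq _ x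
  have hmint : ∀ x : Normalization R, IsIntegral T (m x) := by
    intro x
    have h1 : IsIntegral R (m x) := by
      obtain ⟨Q, hQ, hQx⟩ := x.2
      refine ⟨Q, hQ, ?_⟩
      have hcomp : algebraMap R (FractionRing T) = m.comp (algebraMap R (FractionRing R)) :=
        RingHom.ext fun x => (hm x).symm
      rw [hcomp, ← Polynomial.hom_eval₂]
      exact (congrArg m hQx).trans (map_zero m)
    exact h1.tower_top
  let μ : Normalization R →+* Normalization T :=
    (m.comp (algebraMap (Normalization R) (FractionRing R))).codRestrict _ hmint
  have hμ : ∀ x, μ (algebraMap R _ x) = algebraMap T _ (algebraMap R T x) := fun x =>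
    Subtype.ext ((hm x).trans (IsScalarTower.algebraMap_apply R T (FractionRing T) x))
  obtain ⟨u, hu⟩ := hsurj 1
  refine hg'.surjective_of_apply_eq_one (u := μ u) ?_
  obtain ⟨⟨a, s⟩, hs⟩ := IsLocalization.surj (nonZeroDivisors R) (u : FractionRing R)
  rw [IsRootLinear.apply_map_eq hq (algebraMap R (Normalization R)) μ hg hext hg'
    (s := s) (a := a) (z := u), hu, map_one]
  · intro x
    rw [hμ, hμ, hg'ext, hf'ext]
  · exact Subtype.ext ((mul_comm _ _).trans hs)
  · refine comap_nonZeroDivisors_le_of_injective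
      (f := algebraMap (Normalization T) (FractionRing T)) Subtype.val_injective ?_
    change m (algebraMap R (FractionRing R) s) ∈ nonZeroDivisors (FractionRing T)
    rw [hm]
    exact (hnzd s s.2).mem_nonZeroDivisors

/-- For `q = 1` stable ideals need not be radical. Instead `f` is multiplication by `f 1`, which is
a unit in the normalization and hence, by integrality, in `R`. -/
theorem IsRootLinear.surjective_of_pow_zero {p : ℕ} {R : Type u} [CommRing R] {f : R →+ R}
    (hf : IsRootLinear (p ^ 0) f) {g : Normalization R →+ Normalization R}
    (hg : IsRootLinear (p ^ 0) g) (hext : ∀ x, g (algebraMap R _ x) = algebraMap R _ (f x))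
    (hsurj : Function.Surjective g) : Function.Surjective f := by
  have : FaithfulSMul R (Normalization R) :=
    (faithfulSMul_iff_algebraMap_injective _ _).2 (algebraMap_normalization_injective R)
  obtain ⟨u, hu⟩ := hsurj 1
  have h1 : u * algebraMap R _ (f 1) = 1 := by
    rw [← hext, map_one, ← hg, pow_zero, pow_one, mul_one, hu]
  have h2 : IsUnit (algebraMap R (Normalization R) (f 1)) := .of_mul_eq_one_right u h1
  obtain ⟨c, hc⟩ := ((isUnit_map_iff (algebraMap R (Normalization R)) _).1 h2).exists_left_inv
  exact hf.surjective_of_apply_eq_one (u := c ^ p ^ 0 * 1) (by rw [hf, hc])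

theorem HereditarySurjectiveTrace.surjective {R : Type u} [CommRing R] [IsNoetherianRing R]
    (hR : HereditarySurjectiveTrace R) (p e : ℕ) [hp : Fact p.Prime] [CharP R p] {f : R →+ R}
    {g : Normalization R →+ Normalization R} (hf : IsRootLinear (p ^ e) f)
    (hg : IsRootLinear (p ^ e) g) (hext : ∀ x, g (algebraMap R _ x) = algebraMap R _ (f x))
    (hsurj : Function.Surjective g) : Function.Surjective f := by
  obtain rfl | he := eq_or_ne e 0
  · exact hf.surjective_of_pow_zero hg hext hsurj
  have hq : p ^ e ≠ 0 := pow_ne_zero _ hp.out.ne_zero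
  let I : Ideal R :=
    { carrier := Set.range f
      zero_mem' := ⟨0, map_zero f⟩
      add_mem' := by
        rintro _ _ ⟨x, rfl⟩ ⟨y, rfl⟩
        exact ⟨x + y, map_add f x y⟩
      smul_mem' := by
        rintro r _ ⟨x, rfl⟩
        exact ⟨r ^ p ^ e * x, hf r x⟩ }
  suffices h : I = ⊤ by
    obtain ⟨u, hu⟩ := (Ideal.eq_top_iff_one I).1 h
    exact hf.surjective_of_apply_eq_one hu
  by_contra hI
  obtain ⟨P, hP, hIP⟩ := Ideal.exists_le_maximal I hI
  have := hP.isPrime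
  let T := Localization.AtPrime P
  have : IsNoetherianRing T := IsLocalization.isNoetherianRing P.primeCompl T inferInstance
  have : CharP T p := charP_of_ringHom_of_nontrivial (algebraMap R T) p
  obtain ⟨f', g', hf', hg', hf'ext, hg'ext, hg'surj⟩ :=
    hf.exists_localization_extension hq hg hext hsurj P
  obtain ⟨z, hz⟩ := (hR P).surjective p e he hf' hg' hg'ext hg'surj 1
  obtain ⟨⟨a, s⟩, hs⟩ := IsLocalization.surj P.primeCompl z
  have h1 := hf'.mul_apply_eq hq (algebraMap R T) hf'ext ((mul_comm _ _).trans hs)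
  rw [hz, mul_one] at h1
  -- Since `f' z = 1` with `z = a / s`, the denominator `s` equals `f (s ^ (q - 1) * a)` in `T`, a
  -- value in `I ⊆ P`; but `s ∉ P`.
  have h2 : algebraMap R T s ∈ P.map (algebraMap R T) := by
    rw [h1]
    exact Ideal.mem_map_of_mem _ (hIP ⟨_, rfl⟩)
  rw [Localization.AtPrime.map_eq_maximalIdeal] at h2
  exact h2 (IsLocalization.map_units T s)

theorem theorem3p6 (p : ℕ) [Fact p.Prime] (R : Type u) [CommRing R] [CharP R p]
    [IsNoetherianRing R] [IsReduced R] (hF : IsFFinite p R) (hR : HereditarySurjectiveTrace R)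
    (e : ℕ) (φ : FrobeniusPushforward p e R →ₗ[R] R) :
    ∃ ψ : FrobeniusPushforward p e (Normalization R) →ₗ[Normalization R] Normalization R,
      ExtendsToNormalization p e R φ ψ ∧
      (∀ ψ' : FrobeniusPushforward p e (Normalization R) →ₗ[Normalization R] Normalization R,
        ExtendsToNormalization p e R φ ψ' → ψ' = ψ) ∧
      (Function.Surjective ψ → Function.Surjective φ) := by
  have hq : p ^ e ≠ 0 := pow_ne_zero _ (Fact.out : p.Prime).ne_zero
  have hf := FrobeniusPushforward.isRootLinear_toAddHom φ
  obtain ⟨g, hg, hext⟩ := hf.exists_extension_normalization hq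
  refine ⟨hg.toLinearMap, hext, fun ψ' hψ' => LinearMap.ext fun x => ?_, fun hsurj => ?_⟩
  · obtain ⟨x, rfl⟩ := (FrobeniusPushforward.of p e (Normalization R)).surjective x
    obtain ⟨⟨a, s⟩, hs⟩ := IsLocalization.surj (nonZeroDivisors R) (x : FractionRing R)
    refine IsRootLinear.apply_map_eq hq (algebraMap R (Normalization R)) (RingHom.id _) hg hext
      (FrobeniusPushforward.isRootLinear_toAddHom ψ') hψ' (s := s) (a := a)
      (Subtype.ext ((mul_comm _ _).trans hs)) ?_
    refine comap_nonZeroDivisors_le_of_injective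
      (f := algebraMap (Normalization R) (FractionRing R)) Subtype.val_injective ?_
    exact (IsLocalization.map_units (FractionRing R) s).mem_nonZeroDivisors
  · exact hR.surjective p e hf hg hext hsurj
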